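/- All digraphs $G=(V,E)$ are finite, with $E\subseteq V\times V$ (no parallel edges), and $n=|V|$. A digraph is strongly connected if there is a directed path from every vertex to every vertex. Let $G=(V,E)$ be a strongly connected digraph. An edge $e\in E$ is a strong bridge of $G$ if $(V,E\setminus\{e\})$ is not strongly connected, and a vertex $w\in V$ is a strong articulation point of $G$ if the subgraph $G\setminus\{w\}$ obtained by deleting $w$ is not strongly connected. $G$ is $2$-edge-connected if it is strongly connected and has no strong bridge. For $T\subseteq V$, $G$ is $2$-$T$-connected if it is $2$-edge-connected and no vertex of $T$ is a strong articulation point of $G$. $G$ is minimal $2$-$T$-connected if it is $2$-$T$-connected but, for every $e\in E$, the subgraph $(V,E\setminus\{e\})$ is not $2$-$T$-connected. Then, for every $T\subseteq V$, every minimal $2$-$T$-connected digraph $G=(V,E)$ with $n$ vertices has at most $8n$ edges: $|E|\le 8n$. -/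

import Mathlib

namespace Digraph

/-- The set of edges `(u, v)` of a directed graph. -/
def edgeSet {V : Type*} (G : Digraph V) : Set (V × V) :=
  {e | G.Adj e.1 e.2}

/-- The spanning subgraph `(V, E \ {e})`. -/
def deleteEdge {V : Type*} (G : Digraph V) (e : V × V) : Digraph V where
  Adj u v := G.Adj u v ∧ (u, v) ≠ e

/-- The subgraph `G \ {w}`, induced on the vertices different from `w`. -/
def deleteVertex {V : Type*} (G : Digraph V) (w : V) : Digraph {v : V // v ≠ w} where
  Adj u v := G.Adj u v

/-- There is a directed path (possibly of length zero) from every vertex to every vertex. -/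
def StronglyConnected {V : Type*} (G : Digraph V) : Prop :=
  ∀ u v : V, Relation.ReflTransGen G.Adj u v

/-- `w` is a strong articulation point of the (strongly connected) graph `G`:
`G \ {w}` is not strongly connected. -/
def IsStrongArticulationPoint {V : Type*} (G : Digraph V) (w : V) : Prop :=
  ¬ (G.deleteVertex w).StronglyConnected

/-- `e` is a strong bridge of the (strongly connected) graph `G`: it is an edge, and
`(V, E \ {e})` is not strongly connected. -/
def IsStrongBridge {V : Type*} (G : Digraph V) (e : V × V) : Prop :=
  e ∈ G.edgeSet ∧ ¬ (G.deleteEdge e).StronglyConnected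

/-- `G` is strongly connected and has no strong bridge. -/
def TwoEdgeConnected {V : Type*} (G : Digraph V) : Prop :=
  G.StronglyConnected ∧ ∀ e ∈ G.edgeSet, ¬ G.IsStrongBridge e

/-- `G` is 2-edge-connected and no vertex of `T` is a strong articulation point. -/
def TwoTConnected {V : Type*} (G : Digraph V) (T : Set V) : Prop :=
  G.TwoEdgeConnected ∧ ∀ w ∈ T, ¬ G.IsStrongArticulationPoint w

/-- `G` is 2-T-connected, and deleting any single edge destroys this. -/
def MinimalTwoTConnected {V : Type*} (G : Digraph V) (T : Set V) : Prop :=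
  G.TwoTConnected T ∧ ∀ e ∈ G.edgeSet, ¬ (G.deleteEdge e).TwoTConnected T

end Digraph

/-! Fix a root `s`. A digraph is 2-T-connected as soon as `s` reaches every vertex after deletion of
any edge or any vertex of `T` other than `s`, the same holds in the reversed digraph, and, if `s ∈
T`, deleting `s` leaves a strongly connected digraph. By a Menger-type cut argument the reachability
conditions say that every bi-set avoiding `s` has degree at least 2, a wall vertex counting like an
entering edge. This degree is submodular, so tight bi-sets can be uncrossed; hence an edge-minimal
solution has in-degrees at most 2 and at most `2n` edges. The condition on deleting `s` costs `2n`
more, by an out- and an in-branching. The union of the three parts, at most `6n` edges, is already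
2-T-connected, so minimality forces it to be all of `E`. -/

open Classical in
/-- The edges of `E` that enter the bi-set with inner set `I` and outer set `O`. -/
noncomputable def cutEdges {V : Type*} (E : Finset (V × V)) (I O : Finset V) : Finset (V × V) :=
  E.filter fun e => e.1 ∉ O ∧ e.2 ∈ I

/-- `I ⊆ O` is a bi-set with nonempty inner set, avoiding the root `s`, and whose wall `O \ I`
is contained in `T`. -/
structure IsBiset {V : Type*} (s : V) (T : Set V) (I O : Finset V) : Prop where
  subset : I ⊆ O
  nonempty : I.Nonempty
  root : s ∉ O
  wall : ∀ x ∈ O, x ∉ I → x ∈ T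

open Classical in
/-- The number of edges entering a bi-set plus the size of its wall. -/
noncomputable def bisetDegree {V : Type*} (E : Finset (V × V)) (I O : Finset V) : ℕ :=
  (cutEdges E I O).card + (O \ I).card

/-- Every bi-set avoiding the root `s` with wall in `T` has degree at least `k`. -/
def RootConnected {V : Type*} (k : ℕ) (s : V) (T : Set V) (E : Finset (V × V)) : Prop :=
  ∀ I O, IsBiset s T I O → k ≤ bisetDegree E I O

/-! ### Uncrossing bi-sets -/

open Classical in
theorem IsBiset.inter {V : Type*} {s : V} {T : Set V} {I O I' O' : Finset V}
    (h : IsBiset s T I O) (h' : IsBiset s T I' O') (hne : (I ∩ I').Nonempty) :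
    IsBiset s T (I ∩ I') (O ∩ O') where
  subset := Finset.inter_subset_inter h.subset h'.subset
  nonempty := hne
  root := fun hs => h.root (Finset.mem_inter.1 hs).1
  wall := by
    intro x hx hxI
    rw [Finset.mem_inter] at hx hxI
    by_cases hI : x ∈ I
    · exact h'.wall x hx.2 fun hI' => hxI ⟨hI, hI'⟩
    · exact h.wall x hx.1 hI

open Classical in
theorem IsBiset.union {V : Type*} {s : V} {T : Set V} {I O I' O' : Finset V}
    (h : IsBiset s T I O) (h' : IsBiset s T I' O') :
    IsBiset s T (I ∪ I') (O ∪ O') where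
  subset := Finset.union_subset_union h.subset h'.subset
  nonempty := h.nonempty.mono Finset.subset_union_left
  root := fun hs => (Finset.mem_union.1 hs).elim h.root h'.root
  wall := by
    intro x hx hxI
    rw [Finset.mem_union, not_or] at hxI
    exact (Finset.mem_union.1 hx).elim (fun hO => h.wall x hO hxI.1) fun hO => h'.wall x hO hxI.2

/-- Reduces submodularity to counting the contribution of one edge or one vertex. -/
theorem card_filter_add_card_filter_le {α : Type*} (s : Finset α) {p q r t : α → Prop}
    [DecidablePred p] [DecidablePred q] [DecidablePred r] [DecidablePred t]
    (h : ∀ x ∈ s, (if p x then 1 else 0) + (if q x then 1 else 0) ≤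
      (if r x then 1 else 0) + (if t x then 1 else 0)) :
    (s.filter p).card + (s.filter q).card ≤ (s.filter r).card + (s.filter t).card := by
  simp only [Finset.card_filter, ← Finset.sum_add_distrib]
  exact Finset.sum_le_sum h

open Classical in
theorem bisetDegree_submodular {V : Type*} (E : Finset (V × V)) {I O I' O' : Finset V}
    (h : I ⊆ O) (h' : I' ⊆ O') :
    bisetDegree E (I ∩ I') (O ∩ O') + bisetDegree E (I ∪ I') (O ∪ O') ≤
      bisetDegree E I O + bisetDegree E I' O' := by
  have hcut : (cutEdges E (I ∩ I') (O ∩ O')).card + (cutEdges E (I ∪ I') (O ∪ O')).card ≤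
      (cutEdges E I O).card + (cutEdges E I' O').card := by
    refine card_filter_add_card_filter_le E fun e _ => ?_
    have h₁ := @h e.2
    have h₂ := @h' e.2
    simp only [Finset.mem_inter, Finset.mem_union]
    by_cases a : e.1 ∈ O <;> by_cases b : e.1 ∈ O' <;> by_cases c : e.2 ∈ I <;>
      by_cases d : e.2 ∈ I' <;> simp [a, b, c, d]
  have hwall : ((O ∩ O') \ (I ∩ I')).card + ((O ∪ O') \ (I ∪ I')).card ≤
      (O \ I).card + (O' \ I').card := by
    have key : ∀ A B : Finset V, A ⊆ O ∪ O' → A \ B = (O ∪ O').filter fun x => x ∈ A ∧ x ∉ B := by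
      intro A B hA
      ext x
      simp only [Finset.mem_sdiff, Finset.mem_filter]
      exact ⟨fun hx => ⟨hA hx.1, hx⟩, fun hx => hx.2⟩
    rw [key _ _ (Finset.inter_subset_left.trans Finset.subset_union_left), key _ _ subset_rfl,
      key _ I Finset.subset_union_left, key _ I' Finset.subset_union_right]
    refine card_filter_add_card_filter_le _ fun x _ => ?_
    have h₁ := @h x
    have h₂ := @h' x
    simp only [Finset.mem_inter, Finset.mem_union]
    by_cases a : x ∈ O <;> by_cases b : x ∈ O' <;> by_cases c : x ∈ I <;>
      by_cases d : x ∈ I' <;> simp_all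
  unfold bisetDegree
  omega

open Classical in
/-- The intersection of two bi-sets of degree at most `k` has degree at most `k`. -/
theorem RootConnected.inter_tight {V : Type*} {k : ℕ} {s : V} {T : Set V} {E : Finset (V × V)}
    (hE : RootConnected k s T E) {I O I' O' : Finset V}
    (h : IsBiset s T I O) (h' : IsBiset s T I' O') (hk : bisetDegree E I O ≤ k)
    (hk' : bisetDegree E I' O' ≤ k) :
    bisetDegree E (I ∩ I') (O ∩ O') ≤ k := by
  have := bisetDegree_submodular E h.subset h'.subset
  have := hE _ _ (h.union h')
  omega

/-! ### Sparsity of edge-minimal solutions -/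

open Classical in
/-- An edge whose deletion destroys `RootConnected` enters a tight bi-set. -/
theorem RootConnected.exists_tight {V : Type*} {k : ℕ} {s : V} {T : Set V} {E : Finset (V × V)}
    (hE : RootConnected k s T E) {e : V × V}
    (hcrit : ¬ RootConnected k s T (E.erase e)) :
    ∃ I O, IsBiset s T I O ∧ bisetDegree E I O ≤ k ∧ e.1 ∉ O ∧ e.2 ∈ I := by
  simp only [RootConnected, not_forall, not_le] at hcrit
  obtain ⟨I, O, h, hlt⟩ := hcrit
  have hsub : cutEdges E I O ⊆ insert e (cutEdges (E.erase e) I O) := by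
    intro x hx
    simp only [cutEdges, Finset.mem_insert, Finset.mem_filter, Finset.mem_erase] at hx ⊢
    by_cases hxe : x = e
    · exact Or.inl hxe
    · exact Or.inr ⟨⟨hxe, hx.1⟩, hx.2⟩
  have hcard := (Finset.card_le_card hsub).trans (Finset.card_insert_le _ _)
  have hk := hE I O h
  refine ⟨I, O, h, ?_, ?_⟩
  · unfold bisetDegree at hlt ⊢
    omega
  · by_contra hcon
    have heq : cutEdges (E.erase e) I O = cutEdges E I O := by
      ext x
      simp only [cutEdges, Finset.mem_filter, Finset.mem_erase]
      refine ⟨fun hx => ⟨hx.1.2, hx.2⟩, fun hx => ⟨⟨?_, hx.1⟩, hx.2⟩⟩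
      rintro rfl
      exact hcon hx.2
    unfold bisetDegree at hlt hk
    rw [heq] at hlt
    omega

open Classical in
/-- In an edge-minimal `RootConnected` edge set all in-degrees are at most `k`. -/
theorem RootConnected.card_inEdges_le {V : Type*} {k : ℕ} {s : V} {T : Set V}
    {E : Finset (V × V)} (hE : RootConnected k s T E)
    (hmin : ∀ e ∈ E, ¬ RootConnected k s T (E.erase e)) (v : V) :
    (E.filter fun e => e.2 = v).card ≤ k := by
  rcases (E.filter fun e => e.2 = v).eq_empty_or_nonempty with h0 | ⟨e₀, he₀⟩
  · simp [h0]
  -- A smallest tight bi-set around `v` is entered by every edge into `v`, so its degree bounds the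
  -- in-degree.
  let Q : ℕ → Prop := fun m => ∃ I O, IsBiset s T I O ∧ bisetDegree E I O ≤ k ∧ v ∈ I ∧
    I.card + O.card = m
  have hQ : ∃ m, Q m := by
    rw [Finset.mem_filter] at he₀
    obtain ⟨I, O, h, hk, -, h2⟩ := hE.exists_tight (hmin e₀ he₀.1)
    exact ⟨_, I, O, h, hk, he₀.2 ▸ h2, rfl⟩
  obtain ⟨I, O, h, hk, hv, hm⟩ := Nat.find_spec hQ
  have hsub : (E.filter fun e => e.2 = v) ⊆ cutEdges E I O := by
    intro e he
    rw [Finset.mem_filter] at he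
    obtain ⟨I', O', h', hk', h1, h2⟩ := hE.exists_tight (hmin e he.1)
    rw [he.2] at h2
    have hv' : v ∈ I ∩ I' := Finset.mem_inter.2 ⟨hv, h2⟩
    have hle := Nat.find_min' hQ ⟨I ∩ I', O ∩ O', h.inter h' ⟨v, hv'⟩,
      hE.inter_tight h h' hk hk', hv', rfl⟩
    have hI : (I ∩ I').card ≤ I.card := Finset.card_le_card Finset.inter_subset_left
    -- Minimality of `I.card + O.card` gives `O ⊆ O'`, so the tail of `e`, lying outside `O'`, lies
    -- outside `O`.
    have hO : O ∩ O' = O := Finset.eq_of_subset_of_card_le Finset.inter_subset_left (by omega)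
    refine Finset.mem_filter.2 ⟨he.1, fun hmem => h1 ?_, he.2 ▸ hv⟩
    rw [← hO] at hmem
    exact (Finset.mem_inter.1 hmem).2
  exact (Finset.card_le_card hsub).trans ((Nat.le_add_right _ _).trans hk)

open Classical in
/-- Every `RootConnected` edge set contains a sparse one. -/
theorem RootConnected.exists_sparse {V : Type*} [Fintype V] {k : ℕ} {s : V} {T : Set V}
    {E : Finset (V × V)} (hE : RootConnected k s T E) :
    ∃ F ⊆ E, RootConnected k s T F ∧ F.card ≤ k * Fintype.card V := by
  induction E using Finset.strongInduction with
  | H E ih =>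
    by_cases hmin : ∀ e ∈ E, ¬ RootConnected k s T (E.erase e)
    · refine ⟨E, subset_rfl, hE, ?_⟩
      rw [Finset.card_eq_sum_card_fiberwise (f := Prod.snd) (t := Finset.univ) (by simp)]
      refine (Finset.sum_le_card_nsmul _ _ k fun v _ => hE.card_inEdges_le hmin v).trans ?_
      rw [smul_eq_mul, mul_comm, Finset.card_univ]
    · push Not at hmin
      obtain ⟨e, he, hrc⟩ := hmin
      obtain ⟨F, hF, h⟩ := ih _ (Finset.erase_ssubset he) hrc
      exact ⟨F, hF.trans (Finset.erase_subset _ _), h⟩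

/-! ### Reachability from the root as a cut condition -/

theorem reflTransGen_imp {V : Type*} {R R' : V → V → Prop} {u v : V}
    (hR : ∀ a b, R a b → R' a b) (h : Relation.ReflTransGen R u v) :
    Relation.ReflTransGen R' u v :=
  h.lift id hR

theorem exists_rel_of_reflTransGen {V : Type*} {R : V → V → Prop} {P : V → Prop} {a b : V}
    (h : Relation.ReflTransGen R a b) (ha : ¬ P a) (hb : P b) :
    ∃ x y, ¬ P x ∧ P y ∧ R x y := by
  induction h with
  | refl => exact absurd hb ha
  | @tail x y _ hxy ih =>
    by_cases hx : P x
    · exact ih hx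
    · exact ⟨x, y, hx, hb, hxy⟩

/-- The root `s` reaches every vertex after deletion of any edge, or of any vertex of `T`. -/
def RobustlyReaches {V : Type*} (R : V → V → Prop) (s : V) (T : Set V) : Prop :=
  (∀ e v, Relation.ReflTransGen (fun a b => R a b ∧ (a, b) ≠ e) s v) ∧
    ∀ w ∈ T, w ≠ s → ∀ v, v ≠ w →
      Relation.ReflTransGen (fun a b => R a b ∧ a ≠ w ∧ b ≠ w) s v

open Classical in
theorem RobustlyReaches.rootConnected {V : Type*} {s : V} {T : Set V} {E : Finset (V × V)}
    (h : RobustlyReaches (fun a b => (a, b) ∈ E) s T) : RootConnected 2 s T E := by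
  intro I O hbi
  obtain ⟨x, hx⟩ := hbi.nonempty
  have hs : s ∉ I := fun hs => hbi.root (hbi.subset hs)
  by_contra! hlt
  unfold bisetDegree at hlt
  -- Degree at most 1 means an empty wall and at most one entering edge, or a single wall vertex and
  -- no entering edge; deleting that edge or vertex would cut `s` off from `I`.
  rcases Nat.eq_zero_or_pos (O \ I).card with h0 | hpos
  · have hOI : O = I := (Finset.sdiff_eq_empty_iff_subset.1 (Finset.card_eq_zero.1 h0)).antisymm
      hbi.subset
    obtain ⟨e, he⟩ : ∃ e, ∀ f ∈ cutEdges E I O, f = e := by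
      rcases (cutEdges E I O).eq_empty_or_nonempty with hc | ⟨e, he⟩
      · exact ⟨(s, s), by simp [hc]⟩
      · exact ⟨e, fun f hf => Finset.card_le_one.1 (by omega) f hf e he⟩
    obtain ⟨a, b, ha, hb, hab, hne⟩ :=
      exists_rel_of_reflTransGen (P := (· ∈ I)) (h.1 e x) hs hx
    exact hne (he _ (Finset.mem_filter.2 ⟨hab, hOI ▸ ha, hb⟩))
  · obtain ⟨w, hw⟩ := Finset.card_eq_one.1 (show (O \ I).card = 1 by omega)
    have hwm : w ∈ O ∧ w ∉ I := Finset.mem_sdiff.1 (hw ▸ Finset.mem_singleton_self w)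
    obtain ⟨a, b, ha, hb, hab, hne, -⟩ := exists_rel_of_reflTransGen (P := (· ∈ I))
      (h.2 w (hbi.wall w hwm.1 hwm.2) (fun hws => hbi.root (hws ▸ hwm.1)) x
        fun hxw => hwm.2 (hxw ▸ hx)) hs hx
    have haO : a ∉ O := fun haO => hne
      (Finset.mem_singleton.1 (hw ▸ Finset.mem_sdiff.2 ⟨haO, ha⟩))
    have : 0 < (cutEdges E I O).card :=
      Finset.card_pos.2 ⟨(a, b), Finset.mem_filter.2 ⟨hab, haO, hb⟩⟩
    omega

open Classical in
theorem RootConnected.robustlyReaches {V : Type*} [Fintype V] {s : V} {T : Set V}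
    {E : Finset (V × V)} (h : RootConnected 2 s T E) :
    RobustlyReaches (fun a b => (a, b) ∈ E) s T := by
  refine ⟨fun e v => ?_, fun w hw hws v hvw => ?_⟩
  · by_contra hv
    set R : V → V → Prop := fun a b => (a, b) ∈ E ∧ (a, b) ≠ e
    -- Only `e` can enter the unreached set, yet its degree is at least 2.
    let I : Finset V := Finset.univ.filter fun x => ¬ Relation.ReflTransGen R s x
    have hI : ∀ x, x ∈ I ↔ ¬ Relation.ReflTransGen R s x := by simp [I]
    have hd := h I I ⟨subset_rfl, ⟨v, (hI v).2 hv⟩, fun hs => (hI s).1 hs .refl,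
      fun x hx hx' => absurd hx hx'⟩
    rw [bisetDegree, sdiff_self, Finset.bot_eq_empty, Finset.card_empty, add_zero] at hd
    obtain ⟨f, hf, hfe⟩ := Finset.exists_mem_ne (Nat.lt_of_succ_le hd) e
    obtain ⟨hfE, hf1, hf2⟩ := Finset.mem_filter.1 hf
    exact (hI _).1 hf2 (Relation.ReflTransGen.tail (not_not.1 fun hn => hf1 ((hI _).2 hn))
      ⟨hfE, hfe⟩)
  · by_contra hv
    set R : V → V → Prop := fun a b => (a, b) ∈ E ∧ a ≠ w ∧ b ≠ w
    let I : Finset V := Finset.univ.filter fun x => x ≠ w ∧ ¬ Relation.ReflTransGen R s x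
    have hI : ∀ x, x ∈ I ↔ x ≠ w ∧ ¬ Relation.ReflTransGen R s x := by simp [I]
    have hwI : w ∉ I := fun hwI => ((hI w).1 hwI).1 rfl
    -- The wall `{w}` contributes 1, so some edge not leaving `w` enters the unreached set.
    have hd := h I (insert w I) ⟨Finset.subset_insert _ _, ⟨v, (hI v).2 ⟨hvw, hv⟩⟩,
      fun hs => (Finset.mem_insert.1 hs).elim (fun hsw => hws hsw.symm)
        fun hs => ((hI s).1 hs).2 .refl,
      fun x hx hx' => (Finset.mem_insert.1 hx).elim (fun hxw => hxw ▸ hw) fun hx => absurd hx hx'⟩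
    have hwall : (insert w I \ I).card = 1 := by
      rw [Finset.insert_sdiff_of_notMem _ hwI, sdiff_self]
      rfl
    rw [bisetDegree, hwall] at hd
    obtain ⟨f, hf⟩ := Finset.card_pos.1 (show 0 < (cutEdges E I (insert w I)).card by omega)
    obtain ⟨hfE, hf1, hf2⟩ := Finset.mem_filter.1 hf
    rw [Finset.mem_insert, not_or] at hf1
    refine ((hI _).1 hf2).2 (Relation.ReflTransGen.tail (b := f.1) ?_
      ⟨hfE, hf1.1, ((hI _).1 hf2).1⟩)
    by_contra hn
    exact hf1.2 ((hI _).2 ⟨hf1.1, hn⟩)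

open Classical in
/-- A graph in which `s` robustly reaches all vertices has a sparse subgraph with this property. -/
theorem RobustlyReaches.exists_sparse {V : Type*} [Fintype V] {s : V} {T : Set V}
    {R : V → V → Prop} (h : RobustlyReaches R s T) :
    ∃ F : Finset (V × V), (∀ e ∈ F, R e.1 e.2) ∧
      RobustlyReaches (fun a b => (a, b) ∈ F) s T ∧ F.card ≤ 2 * Fintype.card V := by
  let E : Finset (V × V) := Finset.univ.filter fun e => R e.1 e.2
  have hR : R = fun a b => (a, b) ∈ E := by
    ext a b
    simp [E]
  obtain ⟨F, hF, hrc, hc⟩ := (hR ▸ h).rootConnected.exists_sparse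
  exact ⟨F, fun e he => (Finset.mem_filter.1 (hF he)).2, hrc.robustlyReaches, hc⟩

open Classical in
/-- A graph in which `s` reaches all vertices has a subgraph with at most `|V|` edges with this
property. -/
theorem exists_sparse_of_forall_reflTransGen {V : Type*} [Fintype V] {s : V} {R : V → V → Prop}
    (h : ∀ v, Relation.ReflTransGen R s v) :
    ∃ F : Finset (V × V), (∀ e ∈ F, R e.1 e.2) ∧
      (∀ v, Relation.ReflTransGen (fun a b => (a, b) ∈ F) s v) ∧ F.card ≤ Fintype.card V := by
  let E : Finset (V × V) := Finset.univ.filter fun e => R e.1 e.2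
  -- With `T = ∅` walls are empty, and bi-sets are ordinary sets.
  have hE : RootConnected 1 s ∅ E := by
    intro I O hbi
    obtain ⟨x, hx⟩ := hbi.nonempty
    have hOI : ∀ y ∈ O, y ∈ I := fun y hy => by
      by_contra hn
      exact hbi.wall y hy hn
    obtain ⟨a, b, ha, hb, hab⟩ := exists_rel_of_reflTransGen (P := (· ∈ I)) (h x)
      (fun hs => hbi.root (hbi.subset hs)) hx
    exact (Finset.card_pos.2 ⟨(a, b), Finset.mem_filter.2
      ⟨by simp [E, hab], fun haO => ha (hOI a haO), hb⟩⟩).trans_le (Nat.le_add_right _ _)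
  obtain ⟨F, hF, hrc, hc⟩ := hE.exists_sparse
  refine ⟨F, fun e he => (Finset.mem_filter.1 (hF he)).2, fun v => ?_, by simpa using hc⟩
  by_contra hv
  set R' : V → V → Prop := fun a b => (a, b) ∈ F
  let I : Finset V := Finset.univ.filter fun x => ¬ Relation.ReflTransGen R' s x
  have hI : ∀ x, x ∈ I ↔ ¬ Relation.ReflTransGen R' s x := by simp [I]
  have hd := hrc I I ⟨subset_rfl, ⟨v, (hI v).2 hv⟩, fun hs => (hI s).1 hs .refl,
    fun x hx hx' => absurd hx hx'⟩
  rw [bisetDegree, sdiff_self, Finset.bot_eq_empty, Finset.card_empty, add_zero] at hd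
  obtain ⟨f, hf⟩ := Finset.card_pos.1 hd
  obtain ⟨hfF, hf1, hf2⟩ := Finset.mem_filter.1 hf
  exact (hI _).1 hf2 (Relation.ReflTransGen.tail (not_not.1 fun hn => hf1 ((hI _).2 hn)) hfF)

/-! ### 2-T-connectivity in terms of a root -/

namespace Digraph

open Classical in
/-- Every strongly connected digraph has a strongly connected spanning subgraph with at most
`2 |V|` edges. -/
theorem StronglyConnected.exists_sparse {V : Type*} [Fintype V] {G : Digraph V}
    (h : G.StronglyConnected) :
    ∃ F : Finset (V × V), (∀ e ∈ F, G.Adj e.1 e.2) ∧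
      (∀ u v, Relation.ReflTransGen (fun a b => (a, b) ∈ F) u v) ∧
      F.card ≤ 2 * Fintype.card V := by
  rcases isEmpty_or_nonempty V with hV | ⟨⟨s⟩⟩
  · exact ⟨∅, by simp, fun u => isEmptyElim u, by simp⟩
  obtain ⟨F₁, h₁, hr₁, hc₁⟩ := exists_sparse_of_forall_reflTransGen fun v => h s v
  obtain ⟨F₂, h₂, hr₂, hc₂⟩ := exists_sparse_of_forall_reflTransGen
    (R := Function.swap G.Adj) fun v => (h v s).swap
  refine ⟨F₁ ∪ F₂.image Prod.swap, ?_, fun u v => ?_, ?_⟩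
  · intro e he
    rcases Finset.mem_union.1 he with he | he
    · exact h₁ e he
    · obtain ⟨f, hf, rfl⟩ := Finset.mem_image.1 he
      exact h₂ f hf
  · refine (reflTransGen_imp ?_ (hr₂ u).swap).trans
      (reflTransGen_imp ?_ (hr₁ v))
    · intro a b hab
      exact Finset.mem_union_right _ (Finset.mem_image.2 ⟨(b, a), hab, rfl⟩)
    · intro a b hab
      exact Finset.mem_union_left _ hab
  · have := Finset.card_union_le F₁ (F₂.image Prod.swap)
    have := Finset.card_image_le (s := F₂) (f := Prod.swap)
    omega

theorem reflTransGen_deleteVertex_iff {V : Type*} {G : Digraph V} {w : V} (u v : {v : V // v ≠ w}) :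
    Relation.ReflTransGen (G.deleteVertex w).Adj u v ↔
      Relation.ReflTransGen (fun a b => G.Adj a b ∧ a ≠ w ∧ b ≠ w) u.1 v.1 := by
  constructor
  · exact fun h => h.lift Subtype.val fun a b hab => ⟨hab, a.2, b.2⟩
  · obtain ⟨v, hv⟩ := v
    intro h
    change Relation.ReflTransGen _ u.1 v at h
    induction h with
    | refl => exact .refl
    | @tail b c _ hbc ih => exact (ih hbc.2.1).tail hbc.1

theorem TwoEdgeConnected.stronglyConnected_deleteEdge {V : Type*} {G : Digraph V}
    (h : G.TwoEdgeConnected) (e : V × V) : (G.deleteEdge e).StronglyConnected := by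
  by_cases he : e ∈ G.edgeSet
  · by_contra hn
    exact h.2 e he ⟨he, hn⟩
  · refine fun u v => reflTransGen_imp (fun a b hab => ⟨hab, ?_⟩) (h.1 u v)
    rintro rfl
    exact he hab

theorem TwoTConnected.robustlyReaches {V : Type*} {G : Digraph V} {T : Set V}
    (h : G.TwoTConnected T) (s : V) : RobustlyReaches G.Adj s T :=
  ⟨fun e v => h.1.stronglyConnected_deleteEdge e s v, fun w hw hws v hvw =>
    (reflTransGen_deleteVertex_iff ⟨s, hws.symm⟩ ⟨v, hvw⟩).1 (not_not.1 (h.2 w hw) _ _)⟩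

theorem TwoTConnected.robustlyReaches_swap {V : Type*} {G : Digraph V} {T : Set V}
    (h : G.TwoTConnected T) (s : V) : RobustlyReaches (Function.swap G.Adj) s T := by
  refine ⟨fun e v => ?_, fun w hw hws v hvw => ?_⟩
  · refine reflTransGen_imp ?_ (h.1.stronglyConnected_deleteEdge e.swap v s).swap
    rintro a b ⟨hab, hne⟩
    exact ⟨hab, fun he => hne (by rw [← he]; rfl)⟩
  · refine reflTransGen_imp ?_ ((reflTransGen_deleteVertex_iff ⟨v, hvw⟩
      ⟨s, hws.symm⟩).1 (not_not.1 (h.2 w hw) _ _)).swap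
    exact fun a b hab => ⟨hab.1, hab.2.2, hab.2.1⟩

/-- If `s` robustly reaches and is robustly reached from all vertices, and `G \ {s}` is strongly
connected in case `s ∈ T`, then `G` is 2-T-connected. -/
theorem twoTConnected_of_robustlyReaches {V : Type*} {G : Digraph V} {T : Set V} {s : V}
    (hout : RobustlyReaches G.Adj s T) (hin : RobustlyReaches (Function.swap G.Adj) s T)
    (hs : s ∈ T → (G.deleteVertex s).StronglyConnected) : G.TwoTConnected T := by
  have hdel : ∀ e, (G.deleteEdge e).StronglyConnected := by
    intro e u v
    -- Route from `u` to `v` through `s`.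
    refine (reflTransGen_imp ?_ (hin.1 e.swap u).swap).trans (hout.1 e v)
    rintro a b ⟨hab, hne⟩
    exact ⟨hab, fun he => hne (by rw [← he]; rfl)⟩
  refine ⟨⟨fun u v => reflTransGen_imp (fun a b hab => hab.1) (hdel (s, s) u v),
    fun e _ he => he.2 (hdel e)⟩, fun w hw hart => hart ?_⟩
  by_cases hws : w = s
  · subst hws
    exact hs hw
  · intro u v
    rw [reflTransGen_deleteVertex_iff]
    refine (reflTransGen_imp ?_ (hin.2 w hw hws u u.2).swap).trans
      (hout.2 w hw hws v v.2)
    exact fun a b hab => ⟨hab.1, hab.2.2, hab.2.1⟩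

end Digraph

/-! ### Sparse certificate and conclusion -/

theorem RobustlyReaches.mono {V : Type*} {R R' : V → V → Prop} {s : V} {T : Set V}
    (h : RobustlyReaches R s T) (hR : ∀ a b, R a b → R' a b) : RobustlyReaches R' s T :=
  ⟨fun e v => reflTransGen_imp (fun a b hab => ⟨hR a b hab.1, hab.2⟩) (h.1 e v),
    fun w hw hws v hvw => reflTransGen_imp (fun a b hab => ⟨hR a b hab.1, hab.2⟩)
      (h.2 w hw hws v hvw)⟩

open Classical in
/-- Every 2-T-connected digraph contains at most `6 |V|` edges such that every subgraph containing
these is 2-T-connected. -/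
theorem Digraph.TwoTConnected.exists_certificate {V : Type*} [Fintype V] {G : Digraph V}
    {T : Set V} (h : G.TwoTConnected T) (s : V) :
    ∃ F : Finset (V × V), F.card ≤ 6 * Fintype.card V ∧
      ∀ H : Digraph V, (∀ e ∈ F, G.Adj e.1 e.2 → H.Adj e.1 e.2) → H.TwoTConnected T := by
  obtain ⟨F₁, h₁, hr₁, hc₁⟩ := (h.robustlyReaches s).exists_sparse
  obtain ⟨F₂, h₂, hr₂, hc₂⟩ := (h.robustlyReaches_swap s).exists_sparse
  obtain ⟨F₃, h₃, hr₃, hc₃⟩ : ∃ F : Finset ({v : V // v ≠ s} × {v : V // v ≠ s}),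
      (∀ e ∈ F, G.Adj e.1 e.2) ∧
      (s ∈ T → ∀ u v, Relation.ReflTransGen (fun a b => (a, b) ∈ F) u v) ∧
      F.card ≤ 2 * Fintype.card V := by
    by_cases hs : s ∈ T
    · obtain ⟨F, hF, hr, hc⟩ :=
        Digraph.StronglyConnected.exists_sparse (not_not.1 (h.2 s hs))
      exact ⟨F, hF, fun _ => hr, hc.trans
        (Nat.mul_le_mul_left 2 (Fintype.card_subtype_le _))⟩
    · exact ⟨∅, by simp, fun hs' => absurd hs' hs, by simp⟩
  refine ⟨F₁ ∪ F₂.image Prod.swap ∪ F₃.image (Prod.map Subtype.val Subtype.val), ?_, ?_⟩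
  · have := Finset.card_union_le (F₁ ∪ F₂.image Prod.swap)
      (F₃.image (Prod.map Subtype.val Subtype.val))
    have := Finset.card_union_le F₁ (F₂.image Prod.swap)
    have := Finset.card_image_le (s := F₂) (f := Prod.swap)
    have := Finset.card_image_le (s := F₃) (f := Prod.map Subtype.val Subtype.val)
    omega
  · intro H hH
    refine Digraph.twoTConnected_of_robustlyReaches (s := s) (hr₁.mono fun a b hab => ?_)
      (hr₂.mono fun a b hab => ?_) fun hs u v =>
        reflTransGen_imp (fun a b hab => ?_) (hr₃ hs u v)
    · exact hH (a, b) (Finset.mem_union_left _ (Finset.mem_union_left _ hab)) (h₁ _ hab)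
    · exact hH (b, a) (Finset.mem_union_left _ (Finset.mem_union_right _
        (Finset.mem_image.2 ⟨(a, b), hab, rfl⟩))) (h₂ _ hab)
    · exact hH (a.1, b.1) (Finset.mem_union_right _
        (Finset.mem_image.2 ⟨(a, b), hab, rfl⟩)) (h₃ _ hab)

theorem mainTheorem3 {V : Type*} [Fintype V] (G : Digraph V) (T : Set V)
    (hG : G.MinimalTwoTConnected T) :
    G.edgeSet.ncard ≤ 8 * Fintype.card V := by
  rcases isEmpty_or_nonempty V with hV | ⟨⟨s⟩⟩
  · simp [Set.eq_empty_of_isEmpty G.edgeSet]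
  obtain ⟨F, hc, hF⟩ := hG.1.exists_certificate s
  have hsub : G.edgeSet ⊆ F := by
    intro e he
    by_contra hn
    -- Deleting an edge outside the certificate would preserve 2-T-connectivity.
    refine hG.2 e he (hF _ fun f hf hadj => ⟨hadj, ?_⟩)
    rintro rfl
    exact hn hf
  have := Set.ncard_le_ncard hsub F.finite_toSet
  rw [Set.ncard_coe_finset] at this
  omega
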